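/- Let $\mathcal N$ be an inhomogeneous Poisson point process on $(0,\infty)$ with epochs $0<T_1<T_2<\cdots$ and measurable rate function $\mu$, where $\mu(t)>0$ for Lebesgue-almost every $t>0$ and $M(a,b):=\int_a^b\mu(s)\,ds$ satisfies $M(0,t)<\infty$ for all $t<\infty$. Put $T_0=0$, let $\ell>0$, and let $$D=\min\{T_n:\ n\ge 0,\ T_{n+1}-T_n\ge \ell\}\in[0,\infty]$$ be the first epoch followed by a gap of length at least $\ell$, with $D=\infty$ if there is none. Suppose that $\mu$ is continuous at almost every point of $(0,\infty)$, that $\mu(t)\to\infty$ and $M(t,t+\ell)=\ell\mu(t)+o(1)$ as $t\to\infty$, and that $D<\infty$ almost surely or $$\int_0^\infty e^{-M(t,t+\ell)}\mu(t)\,dt=\infty .$$ Then for every $c\ge 0$, with $f(t)=\int_c^t e^{-\ell\mu(s)}\mu(s)\,ds$, $$\mathbb P(D>t)\approx_{\log}e^{-f(t)}\quad (t\to\infty),\qquad\text{that is,}\qquad \lim_{t\to\infty}\frac{\log \mathbb P(D>t)}{-f(t)}=1 .$$ -/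

import Mathlib

open MeasureTheory ProbabilityTheory Filter Set
open scoped Topology ENNReal

namespace LongestGap

/-- The intensity measure `M(dt) = μ(t) dt` on `(0, ∞)` with rate function `μ`. -/
noncomputable def intensityMeasure (μ : ℝ → ℝ) : Measure ℝ :=
  (volume.restrict (Ioi 0)).withDensity (fun t => ENNReal.ofReal (μ t))

/-- `M(a, b) = ∫_a^b μ(t) dt`. -/
noncomputable def cumIntensity (μ : ℝ → ℝ) (a b : ℝ) : ℝ := ∫ t in a..b, μ t

/-- The standing assumptions on a rate function on `(0, ∞)`: it is measurable, it is
positive almost everywhere, and `M(0, t) < ∞` for every `t`. -/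
structure IsRateFunction (μ : ℝ → ℝ) : Prop where
  aemeasurable : AEMeasurable μ (volume.restrict (Ioi 0))
  pos : ∀ᵐ t ∂(volume.restrict (Ioi (0 : ℝ))), 0 < μ t
  finite : ∀ t : ℝ, intensityMeasure μ (Ioo 0 t) < ⊤

/-- The number of points of the random set `N` in `B`. -/
noncomputable def count {Ω : Type*} (N : Ω → Set ℝ) (B : Set ℝ) (ω : Ω) : ℕ∞ :=
  (N ω ∩ B).encard

/-- The random set `N` is a Poisson point process on `(0, ∞)` with rate function `μ` under `P`:
the number of points in a Borel set `B` is a random variable, it is Poisson distributed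
with mean `M(B)` when `M(B) < ∞`, and the numbers of points in finitely many disjoint Borel sets
are independent. -/
structure IsPoissonPoint {Ω : Type*} [MeasurableSpace Ω] (P : Measure Ω) (μ : ℝ → ℝ)
    (N : Ω → Set ℝ) : Prop where
  subset_Ioi : ∀ ω, N ω ⊆ Ioi 0
  measurable_count : ∀ B : Set ℝ, MeasurableSet B → Measurable (count N B)
  map_count : ∀ B : Set ℝ, MeasurableSet B → intensityMeasure μ B ≠ ⊤ →
    P.map (count N B) =
      (poissonMeasure (intensityMeasure μ B).toNNReal).map (fun n : ℕ => (n : ℕ∞))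
  indep_count : ∀ (n : ℕ) (B : Fin n → Set ℝ), (∀ i, MeasurableSet (B i)) →
    Pairwise (fun i j => Disjoint (B i) (B j)) → iIndepFun (fun i => count N (B i)) P

/-- The first epoch of `S` strictly after `x`; it is `∞` if there is none. -/
noncomputable def nextEpoch (S : Set ℝ) (x : ℝ) : EReal :=
  sInf ((fun y : ℝ => (y : EReal)) '' (S ∩ Ioi x))

/-- `D = min {T_n : T_{n+1} - T_n ≥ ℓ}` for the set `S = {T_1 < T_2 < ...}` of epochs,
with `T_0 = 0`; it is `∞` if there is no gap of length `ℓ`. -/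
noncomputable def firstGap (ℓ : ℝ) (S : Set ℝ) : EReal :=
  sInf ((fun x : ℝ => (x : EReal)) ''
    {x : ℝ | x ∈ insert 0 S ∧ (ℓ : EReal) ≤ nextEpoch S x - (x : EReal)})

/-- Logarithmic asymptotics `g ≈_log h`: `log g(t) / log h(t) → 1` as `t → ∞`. -/
def LogAsymp (g h : ℝ → ℝ) : Prop :=
  Tendsto (fun t => Real.log (g t) / Real.log (h t)) atTop (𝓝 1)

end LongestGap

/-! Almost surely, `D > t` means that every open window of length `ℓ` inside `(0, t + ℓ)` contains
an epoch. Write `p t` for the probability of this covering event. The proof shows that `-log p`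
grows at the rate `e^{-ℓ μ} μ`.

For `s < t` close together, the drop `p s - p t` is the probability that covering breaks down
between `s + ℓ` and `t + ℓ`. Such a breakdown requires an epoch in `(s, t]` followed by none in `(t,
s + ℓ)`. Conversely it is forced by covering up to `t`, an epoch in `(s, t]` and none in `(t, t +
ℓ)`. Independence over disjoint sets, together with positive correlation for the lower bound, puts
the drop between two products close to `P(covered) * M(s, t) * e^{-M(s, s + ℓ)}`
(`prob_isCovered_sub_le`, `le_prob_isCovered_sub`). Since `μ → ∞`, extending the covered stretch by
`ℓ` hardly changes its probability (`eventually_prob_isCovered_le`), so dividing by `p` gives the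
local increments of `-log p` up to a factor near 1.

The assumption on `M(t, t + ℓ)` replaces `e^{-M(s, s + ℓ)} M(s, t)` by the increment of `f`. A
continuous induction turns the local comparisons into a global one (`exists_log_prob_isCovered`),
and the ratio tends to 1 once `f → ∞`. If `f` were bounded, either `p` would stay away from 0 or the
integral assumed infinite would be finite (`tendsto_integral_exp_mul`). -/

namespace LongestGap

/-! ### Covering by windows of length `ℓ` -/

/-- Every open interval of length `ℓ` in `(0, t)` meets `S`. -/
def IsCovered (ℓ t : ℝ) (S : Set ℝ) : Prop :=
  ∀ x, 0 ≤ x → x + ℓ ≤ t → (S ∩ Ioo x (x + ℓ)).Nonempty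

lemma IsCovered.mono_set {ℓ t : ℝ} {S S' : Set ℝ} (h : S ⊆ S') (hS : IsCovered ℓ t S) :
    IsCovered ℓ t S' :=
  fun x h0 hx => (hS x h0 hx).mono (inter_subset_inter_left _ h)

lemma IsCovered.anti {ℓ s t : ℝ} {S : Set ℝ} (h : s ≤ t) (hS : IsCovered ℓ t S) :
    IsCovered ℓ s S :=
  fun x h0 hx => hS x h0 (hx.trans h)

lemma isCovered_of_lt {ℓ t : ℝ} (S : Set ℝ) (h : t < ℓ) : IsCovered ℓ t S :=
  fun x h0 hx => by linarith

/-- Failure of covering, by a limiting procedure over a countable dense set of left end points. -/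
lemma not_isCovered_iff {ℓ t : ℝ} (S : Set ℝ) {D : Set (Icc 0 (t - ℓ))} (hD : Dense D) :
    ¬ IsCovered ℓ t S ↔ ∀ n : ℕ, ∃ q ∈ D,
      S ∩ (Ioo 0 t ∩ Ioo ((q : ℝ) + 1 / ((n : ℝ) + 1)) ((q : ℝ) + ℓ - 1 / ((n : ℝ) + 1))) = ∅ := by
  constructor
  · intro h n
    simp only [IsCovered, not_forall, not_nonempty_iff_eq_empty] at h
    obtain ⟨x, h0, hx, he⟩ := h
    have hn : (0 : ℝ) < 1 / ((n : ℝ) + 1) := by positivity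
    obtain ⟨q, hqD, hq⟩ := Metric.dense_iff.1 hD ⟨x, h0, by linarith⟩ _ hn
    refine ⟨q, hq, ?_⟩
    have hd : |(q : ℝ) - x| < 1 / ((n : ℝ) + 1) := by
      simpa [Subtype.dist_eq, Real.dist_eq] using hqD
    rw [abs_lt] at hd
    refine subset_eq_empty ?_ he
    rintro y ⟨hy, -, hy1, hy2⟩
    exact ⟨hy, by linarith, by linarith⟩
  · intro h hc
    choose q hqD hq using h
    -- The window at a limit `x` of the left end points is the one missed: a point `y` strictly
    -- inside it would lie in the shrunken window at `q (φ n)` for large `n`.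
    obtain ⟨x, φ, hφ, hx⟩ := CompactSpace.tendsto_subseq q
    obtain ⟨y, hyS, hy1, hy2⟩ := hc x x.2.1 (by linarith [x.2.2])
    have hx' : Tendsto (fun n => (q (φ n) : ℝ)) atTop (𝓝 (x : ℝ)) :=
      (continuous_subtype_val.tendsto x).comp hx
    have h1 : Tendsto (fun n => 1 / ((φ n : ℝ) + 1)) atTop (𝓝 0) :=
      tendsto_one_div_add_atTop_nhds_zero_nat.comp hφ.tendsto_atTop
    have e1 := (hx'.add h1).eventually_lt_const (u := y) (by simpa using hy1)
    have e2 := ((hx'.add_const ℓ).sub h1).eventually_const_lt (u := y) (by simpa using hy2)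
    obtain ⟨n, hn1, hn2⟩ := (e1.and e2).exists
    have : y ∈ (∅ : Set ℝ) := by
      rw [← hq (φ n)]
      exact ⟨hyS, ⟨x.2.1.trans_lt hy1, by linarith [x.2.2]⟩, hn1, hn2⟩
    exact this

/-! ### Void events and measurability of covering -/

section Void

variable {Ω : Type*}

/-- The void events `{N ∩ B = ∅}` of measurable subsets `B` of `U`. -/
def voidEvents (N : Ω → Set ℝ) (U : Set ℝ) : Set (Set Ω) :=
  {A | ∃ B ⊆ U, MeasurableSet B ∧ A = {ω | N ω ∩ B = ∅}}

/-- The `σ`-algebra generated by the void events of measurable subsets of `U`. -/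
@[reducible] def voidSigma (N : Ω → Set ℝ) (U : Set ℝ) : MeasurableSpace Ω :=
  MeasurableSpace.generateFrom (voidEvents N U)

lemma isPiSystem_voidEvents (N : Ω → Set ℝ) (U : Set ℝ) : IsPiSystem (voidEvents N U) := by
  rintro _ ⟨B, hB, hBm, rfl⟩ _ ⟨C, hC, hCm, rfl⟩ -
  refine ⟨B ∪ C, union_subset hB hC, hBm.union hCm, ?_⟩
  ext ω
  simp [inter_union_distrib_left]

lemma measurableSet_voidSigma (N : Ω → Set ℝ) {U B : Set ℝ} (hB : B ⊆ U) (hm : MeasurableSet B) :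
    MeasurableSet[voidSigma N U] {ω | N ω ∩ B = ∅} :=
  MeasurableSpace.measurableSet_generateFrom ⟨B, hB, hm, rfl⟩

lemma measurableSet_voidSigma_nonempty (N : Ω → Set ℝ) {U B : Set ℝ} (hB : B ⊆ U)
    (hm : MeasurableSet B) : MeasurableSet[voidSigma N U] {ω | (N ω ∩ B).Nonempty} := by
  have h := (measurableSet_voidSigma N hB hm).compl
  convert h using 1
  ext ω
  simp [nonempty_iff_ne_empty]

lemma voidSigma_mono (N : Ω → Set ℝ) {U V : Set ℝ} (h : U ⊆ V) :
    voidSigma N U ≤ voidSigma N V :=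
  MeasurableSpace.generateFrom_mono fun _ ⟨B, hB, hm, e⟩ => ⟨B, hB.trans h, hm, e⟩

/-- `not_isCovered_iff` leaves only countable operations on void events. Keeping track of `U ∩ Ioo 0
t` is what later gives independence from the process elsewhere. -/
lemma measurableSet_isCovered_inter (N : Ω → Set ℝ) {U : Set ℝ} (hU : MeasurableSet U) (ℓ t : ℝ) :
    MeasurableSet[voidSigma N (U ∩ Ioo 0 t)] {ω | IsCovered ℓ t (N ω ∩ U)} := by
  obtain ⟨D, hDc, hD⟩ := TopologicalSpace.exists_countable_dense (Icc 0 (t - ℓ))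
  rw [← MeasurableSet.compl_iff]
  have : {ω | IsCovered ℓ t (N ω ∩ U)}ᶜ = ⋂ n : ℕ, ⋃ q ∈ D, {ω | N ω ∩ (U ∩ (Ioo 0 t ∩
      Ioo ((q : ℝ) + 1 / ((n : ℝ) + 1)) ((q : ℝ) + ℓ - 1 / ((n : ℝ) + 1)))) = ∅} := by
    ext ω
    simp only [mem_compl_iff, mem_ofPred_eq, not_isCovered_iff _ hD, mem_iInter, mem_iUnion,
      exists_prop, inter_assoc]
  rw [this]
  refine MeasurableSet.iInter fun n => MeasurableSet.biUnion hDc fun q _ => ?_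
  refine measurableSet_voidSigma N ?_ (hU.inter (measurableSet_Ioo.inter measurableSet_Ioo))
  rw [← inter_assoc]
  exact inter_subset_left

lemma measurableSet_isCovered (N : Ω → Set ℝ) (ℓ t : ℝ) :
    MeasurableSet[voidSigma N (Ioo 0 t)] {ω | IsCovered ℓ t (N ω)} := by
  have h := measurableSet_isCovered_inter N MeasurableSet.univ ℓ t
  rw [univ_inter] at h
  simpa only [inter_univ] using h

end Void

/-! ### Independence and void probabilities -/

section PoissonPoint

variable {Ω : Type*} [MeasurableSpace Ω] {P : Measure Ω} {μ : ℝ → ℝ} {N : Ω → Set ℝ}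

lemma IsPoissonPoint.voidSigma_le (hN : IsPoissonPoint P μ N) (U : Set ℝ) :
    voidSigma N U ≤ ‹MeasurableSpace Ω› := by
  refine MeasurableSpace.generateFrom_le ?_
  rintro _ ⟨B, -, hm, rfl⟩
  have := hN.measurable_count B hm (measurableSet_singleton 0)
  simpa [preimage, count] using this

/-- A void event is the event of count 0, so independence of counts gives the product rule on two
π-systems, which suffices. -/
lemma IsPoissonPoint.indep_voidSigma [IsProbabilityMeasure P] (hN : IsPoissonPoint P μ N)
    {U V : Set ℝ} (hUV : Disjoint U V) : Indep (voidSigma N U) (voidSigma N V) P := by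
  refine IndepSets.indep (hN.voidSigma_le U) (hN.voidSigma_le V) (isPiSystem_voidEvents N U)
    (isPiSystem_voidEvents N V) rfl rfl ?_
  rw [IndepSets_iff]
  rintro _ _ ⟨B, hB, hBm, rfl⟩ ⟨C, hC, hCm, rfl⟩
  have hd : Disjoint B C := hUV.mono hB hC
  have hi := hN.indep_count 2 ![B, C] (by simp [Fin.forall_fin_two, hBm, hCm]) (by
    intro i j hij
    fin_cases i <;> fin_cases j <;> simp_all [disjoint_comm])
  have h2 : IndepFun (count N B) (count N C) P := by
    simpa using hi.indepFun (i := 0) (j := 1) (by simp)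
  have h3 := h2.measure_inter_preimage_eq_mul {0} {0} (measurableSet_singleton _)
    (measurableSet_singleton _)
  simpa [preimage, count] using h3

lemma IsPoissonPoint.prob_inter [IsProbabilityMeasure P] (hN : IsPoissonPoint P μ N)
    {U V : Set ℝ} (hUV : Disjoint U V) {A B : Set Ω} (hA : MeasurableSet[voidSigma N U] A)
    (hB : MeasurableSet[voidSigma N V] B) : P.real (A ∩ B) = P.real A * P.real B := by
  simp only [measureReal_def, ((Indep_iff _ _ _).1 (hN.indep_voidSigma hUV)) A B hA hB,
    ENNReal.toReal_mul]

lemma IsPoissonPoint.prob_void (hN : IsPoissonPoint P μ N) {B : Set ℝ}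
    (hB : MeasurableSet B) (hfin : intensityMeasure μ B ≠ ⊤) :
    P.real {ω | N ω ∩ B = ∅} = Real.exp (-(intensityMeasure μ B).toReal) := by
  have h1 := congrArg (fun ν => ν.real {0}) (hN.map_count B hB hfin)
  rw [map_measureReal_apply (hN.measurable_count B hB) (measurableSet_singleton _),
    map_measureReal_apply (measurable_of_countable _) (measurableSet_singleton _)] at h1
  have e1 : count N B ⁻¹' {0} = {ω | N ω ∩ B = ∅} := by
    ext ω; simp [count]
  have e2 : (fun n : ℕ => (n : ℕ∞)) ⁻¹' {0} = {0} := by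
    ext n; simp
  rw [e1, e2] at h1
  rw [h1, poissonMeasure_real_singleton]
  simp [ENNReal.toReal]

/-- The Poisson law, carried to `ℕ∞`, has no mass at `⊤`. -/
lemma IsPoissonPoint.ae_finite (hN : IsPoissonPoint P μ N) {B : Set ℝ}
    (hB : MeasurableSet B) (hfin : intensityMeasure μ B ≠ ⊤) :
    ∀ᵐ ω ∂P, (N ω ∩ B).Finite := by
  have h1 := congrArg (fun ν => ν {⊤}) (hN.map_count B hB hfin)
  rw [Measure.map_apply (hN.measurable_count B hB) (measurableSet_singleton _),
    Measure.map_apply (measurable_of_countable _) (measurableSet_singleton _)] at h1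
  have e2 : (fun n : ℕ => (n : ℕ∞)) ⁻¹' {⊤} = ∅ := by
    ext n; simp
  rw [e2, measure_empty] at h1
  rw [ae_iff]
  convert h1 using 2
  ext ω
  simp [count, encard_eq_top_iff]

end PoissonPoint

/-! ### The first gap in terms of covering -/

section FirstGap

lemma le_nextEpoch_sub_iff {S : Set ℝ} {x ℓ : ℝ} :
    (ℓ : EReal) ≤ nextEpoch S x - (x : EReal) ↔ S ∩ Ioo x (x + ℓ) = ∅ := by
  rw [EReal.le_sub_iff_add_le (by simp) (by simp), nextEpoch, le_sInf_iff]
  constructor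
  · intro h
    by_contra hne
    obtain ⟨y, hyS, hy1, hy2⟩ := nonempty_iff_ne_empty.2 hne
    have := h y ⟨y, ⟨hyS, hy1⟩, rfl⟩
    rw [← EReal.coe_add, EReal.coe_le_coe_iff] at this
    linarith
  · rintro h _ ⟨y, ⟨hyS, hy1⟩, rfl⟩
    rw [← EReal.coe_add, EReal.coe_le_coe_iff]
    by_contra! hlt
    have : y ∈ S ∩ Ioo x (x + ℓ) := ⟨hyS, hy1, by linarith⟩
    rw [h] at this
    exact this

/-- For a locally finite set the first gap starts after `t` if and only if all intervals of
length `ℓ` in `(0, t + ℓ)` are hit. -/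
lemma lt_firstGap_iff {S : Set ℝ} (hS : S ⊆ Ioi 0) (hfin : ∀ n : ℕ, (S ∩ Ioo 0 (n : ℝ)).Finite)
    {ℓ t : ℝ} (ht : 0 ≤ t) : (t : EReal) < firstGap ℓ S ↔ IsCovered ℓ (t + ℓ) S := by
  have hfin' : ∀ r : ℝ, (S ∩ Iic r).Finite := by
    intro r
    obtain ⟨n, hn⟩ := exists_nat_gt r
    exact (hfin n).subset fun y ⟨hy, hyr⟩ => ⟨hy, hS hy, lt_of_le_of_lt hyr hn⟩
  constructor
  · intro h x h0 hx
    by_contra hne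
    rw [not_nonempty_iff_eq_empty] at hne
    have hF : (insert 0 (S ∩ Iic x)).Finite := (hfin' x).insert 0
    -- `z` is the last epoch up to `x`, or 0 if there is none. The gap after it contains the empty
    -- window at `x`.
    obtain ⟨z, hz, hmax⟩ := hF.exists_maximal ⟨0, mem_insert _ _⟩
    have hzx : z ≤ x := by
      rcases hz with rfl | hz
      · exact h0
      · exact hz.2
    have hz' : z ∈ insert 0 S := insert_subset_insert inter_subset_left hz
    have hgap : S ∩ Ioo z (z + ℓ) = ∅ := by
      by_contra hy
      obtain ⟨y, hyS, hy1, hy2⟩ := nonempty_iff_ne_empty.2 hy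
      rcases le_or_gt y x with hyx | hyx
      · exact absurd (hmax (mem_insert_of_mem _ ⟨hyS, hyx⟩) hy1.le) (not_le.2 hy1)
      · have : y ∈ S ∩ Ioo x (x + ℓ) := ⟨hyS, hyx, by linarith⟩
        rw [hne] at this
        exact this
    have hle : firstGap ℓ S ≤ (z : EReal) :=
      sInf_le ⟨z, ⟨hz', le_nextEpoch_sub_iff.2 hgap⟩, rfl⟩
    have := h.trans_le hle
    rw [EReal.coe_lt_coe_iff] at this
    linarith
  · intro h
    -- An infimum of numbers above `t` could equal `t`. Local finiteness leaves an epoch-free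
    -- stretch just after `t`, which makes the bound strict.
    have hF : (S ∩ Ioc t (t + 1)).Finite := (hfin' (t + 1)).subset fun y hy => ⟨hy.1, hy.2.2⟩
    have hnhds : (S ∩ Ioc t (t + 1))ᶜ ∈ 𝓝 t := hF.isClosed.compl_mem_nhds (by simp)
    obtain ⟨u, htu, hu⟩ := exists_Ico_subset_of_mem_nhds hnhds ⟨t + 1, by linarith⟩
    have hb : (t : EReal) < ((min u (t + 1) : ℝ) : EReal) := by
      rw [EReal.coe_lt_coe_iff]
      exact lt_min htu (by linarith)
    refine hb.trans_le (le_sInf ?_)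
    rintro _ ⟨x, ⟨hx, hgap⟩, rfl⟩
    rw [le_nextEpoch_sub_iff] at hgap
    have hx0 : 0 ≤ x := by
      rcases hx with rfl | hx
      · exact le_rfl
      · exact (hS hx).le
    rw [EReal.coe_le_coe_iff]
    by_contra! hlt
    have htx : t < x := by
      by_contra! hxt
      have := h x hx0 (by linarith)
      rw [hgap] at this
      exact this.ne_empty rfl
    have hxS : x ∈ S := by
      rcases hx with rfl | hx
      · linarith
      · exact hx
    exact hu ⟨htx.le, hlt.trans_le (min_le_left _ _)⟩
      ⟨hxS, htx, (hlt.trans_le (min_le_right _ _)).le⟩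

end FirstGap

/-! ### The cumulative intensity -/

section Intensity

variable {μ : ℝ → ℝ}

lemma IsRateFunction.integrableOn (hμ : IsRateFunction μ) {s t : ℝ} (hs : 0 ≤ s) :
    IntegrableOn μ (Ioc s t) := by
  have hsub : Ioc s t ⊆ Ioo 0 (t + 1) := fun x hx => ⟨hs.trans_lt hx.1, by linarith [hx.2]⟩
  refine IntegrableOn.mono_set ?_ hsub
  have hr : (volume.restrict (Ioo 0 (t + 1)) : Measure ℝ) ≤ volume.restrict (Ioi 0) :=
    Measure.restrict_mono_set _ Ioo_subset_Ioi_self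
  refine ⟨(hμ.aemeasurable.mono_measure hr).aestronglyMeasurable, ?_⟩
  have hp : ∀ᵐ x ∂(volume.restrict (Ioo 0 (t + 1))), 0 ≤ μ x :=
    (hμ.pos.filter_mono (ae_mono hr)).mono fun x hx => hx.le
  rw [hasFiniteIntegral_iff_ofReal hp]
  have := hμ.finite (t + 1)
  rwa [intensityMeasure, withDensity_apply _ measurableSet_Ioo,
    Measure.restrict_restrict measurableSet_Ioo,
    inter_eq_self_of_subset_left Ioo_subset_Ioi_self] at this

lemma IsRateFunction.intervalIntegrable (hμ : IsRateFunction μ) {s t : ℝ} (hs : 0 ≤ s)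
    (ht : 0 ≤ t) : IntervalIntegrable μ volume s t :=
  ⟨hμ.integrableOn hs, hμ.integrableOn ht⟩

lemma IsRateFunction.ae_pos_Ioc (hμ : IsRateFunction μ) {s t : ℝ} (hs : 0 ≤ s) :
    ∀ᵐ x ∂(volume.restrict (Ioc s t)), 0 < μ x :=
  hμ.pos.filter_mono (ae_mono (Measure.restrict_mono_set _ fun _ hx => hs.trans_lt hx.1))

lemma IsRateFunction.intensityMeasure_Ioc (hμ : IsRateFunction μ) {s t : ℝ} (hs : 0 ≤ s)
    (hst : s ≤ t) : intensityMeasure μ (Ioc s t) = ENNReal.ofReal (cumIntensity μ s t) := by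
  have hsub : Ioc s t ⊆ Ioi 0 := fun x hx => hs.trans_lt hx.1
  rw [intensityMeasure, withDensity_apply _ measurableSet_Ioc,
    Measure.restrict_restrict measurableSet_Ioc, inter_eq_self_of_subset_left hsub,
    cumIntensity, intervalIntegral.integral_of_le hst,
    ofReal_integral_eq_lintegral_ofReal (hμ.integrableOn hs)]
  exact (hμ.ae_pos_Ioc hs).mono fun x hx => hx.le

lemma IsRateFunction.cumIntensity_nonneg (hμ : IsRateFunction μ) {s t : ℝ} (hs : 0 ≤ s)
    (hst : s ≤ t) : 0 ≤ cumIntensity μ s t :=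
  intervalIntegral.integral_nonneg_of_ae_restrict hst <| by
    rw [← restrict_Ioc_eq_restrict_Icc]
    exact (hμ.ae_pos_Ioc hs).mono fun x hx => hx.le

lemma IsRateFunction.cumIntensity_pos (hμ : IsRateFunction μ) {s t : ℝ} (hs : 0 ≤ s)
    (hst : s < t) : 0 < cumIntensity μ s t := by
  rw [cumIntensity, intervalIntegral.integral_pos_iff_support_of_nonneg_ae']
  · refine ⟨hst, ?_⟩
    have hv : volume (Ioc s t) ≤ volume (Function.support μ ∩ Ioc s t) := by
      rw [← Measure.restrict_apply₀' measurableSet_Ioc.nullMeasurableSet]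
      rw [← Measure.restrict_apply_self volume (Ioc s t)]
      refine measure_mono_ae ?_
      filter_upwards [hμ.ae_pos_Ioc (t := t) hs] with x hx _
      exact hx.ne'
    refine lt_of_lt_of_le ?_ hv
    simpa using hst
  · rw [uIoc_of_le hst.le]
    exact (hμ.ae_pos_Ioc hs).mono fun x hx => hx.le
  · exact hμ.intervalIntegrable hs (hs.trans hst.le)

lemma IsRateFunction.cumIntensity_add (hμ : IsRateFunction μ) {a b c : ℝ} (ha : 0 ≤ a)
    (hb : 0 ≤ b) (hc : 0 ≤ c) :
    cumIntensity μ a b + cumIntensity μ b c = cumIntensity μ a c :=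
  intervalIntegral.integral_add_adjacent_intervals (hμ.intervalIntegrable ha hb)
    (hμ.intervalIntegrable hb hc)

lemma IsRateFunction.continuousOn_cumIntensity (hμ : IsRateFunction μ) :
    ContinuousOn (cumIntensity μ 0) (Ici 0) := by
  -- Nothing is known about `μ` on the negative axis, so it is cut off there before taking a
  -- primitive.
  have hi : ∀ a b : ℝ, IntervalIntegrable ((Ioi 0).indicator μ) volume a b := by
    intro a b
    rw [intervalIntegrable_iff]
    have : IntegrableOn μ (uIoc a b ∩ Ioi 0) := by
      refine (hμ.integrableOn le_rfl (t := max a b)).mono_set ?_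
      rintro x ⟨hx, h0⟩
      exact ⟨h0, hx.2⟩
    rw [IntegrableOn, integrable_indicator_iff measurableSet_Ioi, IntegrableOn,
      Measure.restrict_restrict measurableSet_Ioi, inter_comm]
    exact this
  refine (intervalIntegral.continuous_primitive hi 0).continuousOn.congr fun t ht => ?_
  refine intervalIntegral.integral_congr_uIoo fun x hx => ?_
  rw [uIoo_of_le ht] at hx
  exact (indicator_of_mem hx.1 μ).symm

end Intensity

/-! ### Probability bounds for covering -/

section Bounds

variable {Ω : Type*} [MeasurableSpace Ω] {P : Measure Ω} {μ : ℝ → ℝ}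
  {N : Ω → Set ℝ}

lemma IsPoissonPoint.prob_void_Ioc (hN : IsPoissonPoint P μ N) (hμ : IsRateFunction μ) {s t : ℝ}
    (hs : 0 ≤ s) (hst : s ≤ t) :
    P.real {ω | N ω ∩ Ioc s t = ∅} = Real.exp (-cumIntensity μ s t) := by
  have h := hμ.intensityMeasure_Ioc hs hst
  rw [hN.prob_void measurableSet_Ioc (by simp [h]), h,
    ENNReal.toReal_ofReal (hμ.cumIntensity_nonneg hs hst)]

lemma IsPoissonPoint.prob_void_Ioo (hN : IsPoissonPoint P μ N) (hμ : IsRateFunction μ) {s t : ℝ}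
    (hs : 0 ≤ s) (hst : s ≤ t) :
    P.real {ω | N ω ∩ Ioo s t = ∅} = Real.exp (-cumIntensity μ s t) := by
  have h : intensityMeasure μ (Ioo s t) = ENNReal.ofReal (cumIntensity μ s t) := by
    rw [← hμ.intensityMeasure_Ioc hs hst]
    refine measure_congr ?_
    have hac : intensityMeasure μ ≪ volume :=
      (withDensity_absolutelyContinuous _ _).trans Measure.absolutelyContinuous_restrict
    exact hac.ae_eq Ioo_ae_eq_Ioc
  rw [hN.prob_void measurableSet_Ioo (by simp [h]), h,
    ENNReal.toReal_ofReal (hμ.cumIntensity_nonneg hs hst)]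

lemma IsPoissonPoint.measurableSet_void (hN : IsPoissonPoint P μ N) {B : Set ℝ}
    (hB : MeasurableSet B) : MeasurableSet {ω | N ω ∩ B = ∅} :=
  hN.voidSigma_le B _ (measurableSet_voidSigma N Subset.rfl hB)

lemma IsPoissonPoint.measurableSet_isCovered (hN : IsPoissonPoint P μ N) (ℓ t : ℝ) :
    MeasurableSet {ω | IsCovered ℓ t (N ω)} :=
  hN.voidSigma_le _ _ (LongestGap.measurableSet_isCovered N ℓ t)

lemma IsPoissonPoint.ae_lt_firstGap_iff (hN : IsPoissonPoint P μ N) (hμ : IsRateFunction μ)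
    (ℓ : ℝ) : ∀ᵐ ω ∂P, ∀ t : ℝ, 0 ≤ t →
      ((t : EReal) < firstGap ℓ (N ω) ↔ IsCovered ℓ (t + ℓ) (N ω)) := by
  have h : ∀ᵐ ω ∂P, ∀ n : ℕ, (N ω ∩ Ioo 0 (n : ℝ)).Finite :=
    ae_all_iff.2 fun n => hN.ae_finite measurableSet_Ioo (hμ.finite n).ne
  filter_upwards [h] with ω hω t ht
  exact lt_firstGap_iff (hN.subset_Ioi ω) hω ht

lemma IsPoissonPoint.prob_lt_firstGap (hN : IsPoissonPoint P μ N) (hμ : IsRateFunction μ)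
    (ℓ : ℝ) {t : ℝ} (ht : 0 ≤ t) :
    P.real {ω | (t : EReal) < firstGap ℓ (N ω)} = P.real {ω | IsCovered ℓ (t + ℓ) (N ω)} := by
  refine measureReal_congr ?_
  filter_upwards [hN.ae_lt_firstGap_iff hμ ℓ] with ω hω
  exact propext (hω t ht)

variable [IsProbabilityMeasure P]

lemma IsPoissonPoint.prob_nonempty (hN : IsPoissonPoint P μ N) {B : Set ℝ}
    (hB : MeasurableSet B) :
    P.real {ω | (N ω ∩ B).Nonempty} = 1 - P.real {ω | N ω ∩ B = ∅} := by
  rw [← probReal_compl_eq_one_sub (hN.measurableSet_void hB)]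
  congr 1
  ext ω
  simp [nonempty_iff_ne_empty]

/-- Covering is positively correlated with the presence of a point in `J`. -/
lemma IsPoissonPoint.prob_isCovered_mul_le (hN : IsPoissonPoint P μ N) (ℓ t : ℝ) {J : Set ℝ}
    (hJ : MeasurableSet J) :
    P.real {ω | IsCovered ℓ t (N ω)} * P.real {ω | (N ω ∩ J).Nonempty} ≤
      P.real ({ω | IsCovered ℓ t (N ω)} ∩ {ω | (N ω ∩ J).Nonempty}) := by
  set C := {ω | IsCovered ℓ t (N ω)}
  -- Covering by the points outside `J` is independent of the void event `A`, implies `C`, and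
  -- agrees with `C` on `A`. Hence `C` and `A` are negatively correlated.
  set E := {ω | IsCovered ℓ t (N ω ∩ Jᶜ)}
  set A := {ω | N ω ∩ J = ∅}
  have hA : MeasurableSet A := hN.measurableSet_void hJ
  have hEC : E ⊆ C := fun ω h => IsCovered.mono_set inter_subset_left h
  have h1 : C ∩ A = E ∩ A := by
    ext ω
    refine and_congr_left fun hA => ?_
    have : N ω ∩ Jᶜ = N ω := by
      rw [← sdiff_eq]
      exact (disjoint_iff_inter_eq_empty.2 hA).sdiff_eq_left
    simp only [C, E, mem_ofPred_eq, this]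
  have h2 : P.real (E ∩ A) = P.real E * P.real A :=
    hN.prob_inter (U := Jᶜ) (V := J) disjoint_compl_left
      (voidSigma_mono N inter_subset_left _ (measurableSet_isCovered_inter N hJ.compl ℓ t))
      (measurableSet_voidSigma N Subset.rfl hJ)
  have h3 : P.real E ≤ P.real C := measureReal_mono hEC
  have h4 : {ω | (N ω ∩ J).Nonempty} = Aᶜ := by
    ext ω
    simp [A, nonempty_iff_ne_empty]
  have h5 := measureReal_inter_add_sdiff (μ := P) (s := C) hA
  rw [h4, ← sdiff_eq, probReal_compl_eq_one_sub hA]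
  have h6 : P.real E * P.real A ≤ P.real C * P.real A :=
    mul_le_mul_of_nonneg_right h3 measureReal_nonneg
  rw [h1, h2] at h5
  linarith

/-- A missed window must start at some `x` in `(s, t]`, so it contains `(t, s + ℓ)`. The window at
`s` is hit, necessarily in `(s, t]`. The three factors concern the disjoint sets `(0, s)`, `(s, t]`
and `(t, s + ℓ)`. -/
lemma IsPoissonPoint.prob_isCovered_sub_le (hN : IsPoissonPoint P μ N) (hμ : IsRateFunction μ)
    {ℓ s t : ℝ} (hs : 0 ≤ s) (hst : s ≤ t) (hts : t ≤ s + ℓ) :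
    P.real {ω | IsCovered ℓ (s + ℓ) (N ω)} - P.real {ω | IsCovered ℓ (t + ℓ) (N ω)} ≤
      P.real {ω | IsCovered ℓ s (N ω)} * (1 - Real.exp (-cumIntensity μ s t)) *
        Real.exp (-cumIntensity μ t (s + ℓ)) := by
  have hsub : {ω | IsCovered ℓ (t + ℓ) (N ω)} ⊆ {ω | IsCovered ℓ (s + ℓ) (N ω)} :=
    fun ω h => IsCovered.anti (by linarith) h
  have hm := hN.measurableSet_isCovered ℓ (t + ℓ)
  rw [← measureReal_sdiff hsub hm, ← hN.prob_void_Ioc hμ hs hst,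
    ← hN.prob_nonempty measurableSet_Ioc, ← hN.prob_void_Ioo hμ (hs.trans hst) hts]
  have d1 : Disjoint (Ioo 0 s) (Ioc s t) :=
    disjoint_left.2 fun x h1 h2 => absurd h1.2 (not_lt.2 h2.1.le)
  have d2 : Disjoint (Ioc 0 t) (Ioo t (s + ℓ)) :=
    disjoint_left.2 fun x h1 h2 => absurd h1.2 (not_le.2 h2.1)
  have m1 := LongestGap.measurableSet_isCovered N ℓ s
  have m2 := measurableSet_voidSigma_nonempty N Subset.rfl (measurableSet_Ioc (a := s) (b := t))
  rw [← hN.prob_inter d1 m1 m2]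
  have m1' := voidSigma_mono N (fun x hx => ⟨hx.1, (hx.2.trans_le hst).le⟩ :
    Ioo 0 s ⊆ Ioc 0 t) _ m1
  have m2' := voidSigma_mono N (Ioc_subset_Ioc_left hs) _ m2
  rw [← hN.prob_inter d2 (@MeasurableSet.inter _ (voidSigma N (Ioc 0 t)) _ _ m1' m2')
    (measurableSet_voidSigma N Subset.rfl measurableSet_Ioo)]
  refine measureReal_mono ?_
  rintro ω ⟨h1, h2⟩
  simp only [mem_ofPred_eq] at h1 h2
  simp only [IsCovered, not_forall, not_nonempty_iff_eq_empty] at h2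
  obtain ⟨x, h0, hx, he⟩ := h2
  have hsx : s < x := by
    by_contra! hle
    exact (h1 x h0 (by linarith)).ne_empty he
  have hv : N ω ∩ Ioo t (s + ℓ) = ∅ := by
    refine subset_eq_empty ?_ he
    rintro y ⟨hy, hy1, hy2⟩
    exact ⟨hy, by linarith, by linarith⟩
  refine ⟨⟨h1.anti (by linarith), ?_⟩, hv⟩
  obtain ⟨y, hy, hy1, hy2⟩ := h1 s hs le_rfl
  refine ⟨y, hy, hy1, ?_⟩
  by_contra! hty
  have : y ∈ N ω ∩ Ioo t (s + ℓ) := ⟨hy, hty, hy2⟩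
  rw [hv] at this
  exact this

/-- A point in `(s, t]` hits every window that starts by `s` and ends after `t`, while the window at
`t` is empty. Covering up to `t` and the point in `(s, t]` are not independent, so positive
correlation replaces the product rule. -/
lemma IsPoissonPoint.le_prob_isCovered_sub (hN : IsPoissonPoint P μ N) (hμ : IsRateFunction μ)
    {ℓ s t : ℝ} (hs : 0 ≤ s) (hst : s ≤ t) (hts : t ≤ s + ℓ) :
    P.real {ω | IsCovered ℓ t (N ω)} * (1 - Real.exp (-cumIntensity μ s t)) *
        Real.exp (-cumIntensity μ t (t + ℓ)) ≤
      P.real {ω | IsCovered ℓ (s + ℓ) (N ω)} - P.real {ω | IsCovered ℓ (t + ℓ) (N ω)} := by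
  have hsub : {ω | IsCovered ℓ (t + ℓ) (N ω)} ⊆ {ω | IsCovered ℓ (s + ℓ) (N ω)} :=
    fun ω h => IsCovered.anti (by linarith) h
  have hm := hN.measurableSet_isCovered ℓ (t + ℓ)
  rw [← measureReal_sdiff hsub hm, ← hN.prob_void_Ioc hμ hs hst,
    ← hN.prob_nonempty measurableSet_Ioc, ← hN.prob_void_Ioo hμ (hs.trans hst) (by linarith)]
  refine (mul_le_mul_of_nonneg_right (hN.prob_isCovered_mul_le ℓ t measurableSet_Ioc)
    measureReal_nonneg).trans ?_
  have d2 : Disjoint (Ioc 0 t) (Ioo t (t + ℓ)) :=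
    disjoint_left.2 fun x h1 h2 => absurd h1.2 (not_le.2 h2.1)
  have m1 := voidSigma_mono N Ioo_subset_Ioc_self _ (LongestGap.measurableSet_isCovered N ℓ t)
  have m2 := measurableSet_voidSigma_nonempty N (Ioc_subset_Ioc_left hs)
    (measurableSet_Ioc (a := s) (b := t))
  rw [← hN.prob_inter d2 (@MeasurableSet.inter _ (voidSigma N (Ioc 0 t)) _ _ m1 m2)
    (measurableSet_voidSigma N Subset.rfl measurableSet_Ioo)]
  refine measureReal_mono ?_
  rintro ω ⟨⟨h1, y, hy, hy1, hy2⟩, h3⟩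
  simp only [mem_ofPred_eq] at h1 h3
  refine ⟨fun x h0 hx => ?_, fun h => (h t (hs.trans hst) le_rfl).ne_empty h3⟩
  rcases le_or_gt (x + ℓ) t with hxt | hxt
  · exact h1 x h0 hxt
  · exact ⟨y, hy, by linarith, by linarith⟩

/-- Any window starting by `t` and ending after `t` contains `(t - ℓ/2, t]` or `(t, t + ℓ/2)`, so
one point in each half extends the covering by `ℓ`. -/
lemma IsPoissonPoint.mul_le_prob_isCovered_add (hN : IsPoissonPoint P μ N)
    (hμ : IsRateFunction μ) {ℓ t : ℝ} (hℓ : 0 < ℓ) (ht : ℓ / 2 ≤ t) :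
    P.real {ω | IsCovered ℓ t (N ω)} * (1 - Real.exp (-cumIntensity μ (t - ℓ / 2) t)) *
        (1 - Real.exp (-cumIntensity μ t (t + ℓ / 2))) ≤
      P.real {ω | IsCovered ℓ (t + ℓ) (N ω)} := by
  rw [← hN.prob_void_Ioc hμ (by linarith) (by linarith), ← hN.prob_nonempty measurableSet_Ioc,
    ← hN.prob_void_Ioo hμ (by linarith) (by linarith), ← hN.prob_nonempty measurableSet_Ioo]
  refine (mul_le_mul_of_nonneg_right (hN.prob_isCovered_mul_le ℓ t measurableSet_Ioc)
    measureReal_nonneg).trans ?_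
  have d2 : Disjoint (Ioc 0 t) (Ioo t (t + ℓ / 2)) :=
    disjoint_left.2 fun x h1 h2 => absurd h1.2 (not_le.2 h2.1)
  have m1 := voidSigma_mono N Ioo_subset_Ioc_self _ (LongestGap.measurableSet_isCovered N ℓ t)
  have m2 := measurableSet_voidSigma_nonempty N
    (Ioc_subset_Ioc_left (by linarith) : Ioc (t - ℓ / 2) t ⊆ Ioc 0 t) measurableSet_Ioc
  rw [← hN.prob_inter d2 (@MeasurableSet.inter _ (voidSigma N (Ioc 0 t)) _ _ m1 m2)
    (measurableSet_voidSigma_nonempty N Subset.rfl measurableSet_Ioo)]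
  refine measureReal_mono ?_
  rintro ω ⟨⟨h1, y, hy, hy1, hy2⟩, z, hz, hz1, hz2⟩ x h0 hx
  rcases le_or_gt (x + ℓ) t with hxt | hxt
  · exact h1 x h0 hxt
  · rcases le_or_gt x (t - ℓ / 2) with hx2 | hx2
    · exact ⟨y, hy, by linarith, by linarith⟩
    · exact ⟨z, hz, by linarith, by linarith⟩

lemma IsPoissonPoint.prob_isCovered_pos (hN : IsPoissonPoint P μ N) (hμ : IsRateFunction μ)
    {ℓ : ℝ} (hℓ : 0 < ℓ) (t : ℝ) : 0 < P.real {ω | IsCovered ℓ t (N ω)} := by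
  -- At `ℓ / 2` no window fits, so covering is trivial there, and the extension by `ℓ` already
  -- applies.
  have key : ∀ n : ℕ, 0 < P.real {ω | IsCovered ℓ (ℓ / 2 + n * ℓ) (N ω)} := by
    intro n
    induction n with
    | zero =>
      have : {ω | IsCovered ℓ (ℓ / 2 + (0 : ℕ) * ℓ) (N ω)} = univ :=
        eq_univ_of_forall fun ω => isCovered_of_lt _ (by push_cast; linarith)
      rw [this]
      simp
    | succ n ih =>
      have h0 : 0 ≤ (n : ℝ) * ℓ := by positivity
      have h := hN.mul_le_prob_isCovered_add hμ hℓ (t := ℓ / 2 + n * ℓ) (by linarith)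
      have e : ℓ / 2 + ((n + 1 : ℕ) : ℝ) * ℓ = ℓ / 2 + n * ℓ + ℓ := by push_cast; ring
      rw [e]
      refine lt_of_lt_of_le (mul_pos (mul_pos ih ?_) ?_) h
      · have := hμ.cumIntensity_pos (s := ℓ / 2 + n * ℓ - ℓ / 2) (t := ℓ / 2 + n * ℓ)
          (by linarith) (by linarith)
        rw [sub_pos, Real.exp_lt_one_iff]
        linarith
      · have := hμ.cumIntensity_pos (s := ℓ / 2 + n * ℓ) (t := ℓ / 2 + n * ℓ + ℓ / 2)
          (by linarith) (by linarith)
        rw [sub_pos, Real.exp_lt_one_iff]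
        linarith
  obtain ⟨n, hn⟩ := exists_nat_gt (t / ℓ)
  rw [div_lt_iff₀ hℓ] at hn
  exact (key n).trans_le (measureReal_mono fun ω h => IsCovered.anti (by linarith) h)

lemma IsPoissonPoint.tendsto_prob_isCovered (hN : IsPoissonPoint P μ N) (hμ : IsRateFunction μ)
    {ℓ : ℝ} (hfin : ∀ᵐ ω ∂P, firstGap ℓ (N ω) < ⊤) :
    Tendsto (fun t : ℝ => P.real {ω | IsCovered ℓ (t + ℓ) (N ω)}) atTop (𝓝 0) := by
  have hanti : Antitone fun t : ℝ => {ω | IsCovered ℓ (t + ℓ) (N ω)} :=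
    fun s t hst ω h => IsCovered.anti (by linarith) h
  have h := tendsto_measure_iInter_atTop (μ := P)
    (fun t : ℝ => (hN.measurableSet_isCovered ℓ (t + ℓ)).nullMeasurableSet) hanti
    ⟨0, measure_ne_top _ _⟩
  have h0 : P (⋂ t : ℝ, {ω | IsCovered ℓ (t + ℓ) (N ω)}) = 0 := by
    rw [measure_eq_zero_iff_ae_notMem]
    filter_upwards [hN.ae_lt_firstGap_iff hμ ℓ, hfin] with ω h1 h2 h3
    simp only [mem_iInter, mem_ofPred_eq] at h3
    refine h2.ne (EReal.eq_top_iff_forall_lt _ |>.2 fun y => ?_)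
    refine lt_of_le_of_lt ?_ ((h1 (max y 0) (le_max_right _ _)).2 (h3 _))
    exact_mod_cast le_max_left y 0
  rw [h0] at h
  exact (ENNReal.tendsto_toReal ENNReal.zero_ne_top).comp h

end Bounds

/-! ### Real-variable comparison lemmas -/

section Comparison

/-- If the increments of `F` are dominated by those of `G` on short intervals to the right of
every point, then they are dominated on long intervals. -/
lemma sub_le_sub_of_eventually_nhdsGT {F G : ℝ → ℝ} {a b : ℝ} (hab : a ≤ b)
    (hF : ContinuousOn F (Icc a b)) (hG : ContinuousOn G (Icc a b))
    (h : ∀ s ∈ Ico a b, ∀ᶠ t in 𝓝[>] s, F t - F s ≤ G t - G s) : F b - F a ≤ G b - G a := by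
  have hc : IsClosed ({t | F t - F a ≤ G t - G a} ∩ Icc a b) := by
    have h2 : ContinuousOn (fun t => (F t - F a) - (G t - G a)) (Icc a b) :=
      (hF.sub continuousOn_const).sub (hG.sub continuousOn_const)
    have := h2.preimage_isClosed_of_isClosed isClosed_Icc (isClosed_Iic (a := (0 : ℝ)))
    rw [inter_comm]
    simpa only [preimage, mem_Iic, sub_nonpos] using this
  -- Continuous induction from the left end point; no differentiability is needed.
  have := hc.Icc_subset_of_forall_mem_nhdsWithin (by simp) ?_
  · exact this (right_mem_Icc.2 hab)
  · rintro x ⟨hx, hxI⟩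
    filter_upwards [h x hxI] with t ht
    simp only [mem_ofPred_eq] at hx ⊢
    linarith

/-- The values at `t₀` are negligible against `f t`, so the ratio is eventually between `R⁻¹` and
`R` up to `o(1)`, with `R` arbitrarily close to 1. -/
lemma tendsto_div_nhds_one {F f : ℝ → ℝ} (hf : Tendsto f atTop atTop)
    (h : ∀ R : ℝ, 1 < R → ∃ t₀, ∀ t, t₀ ≤ t →
      F t - F t₀ ≤ R * (f t - f t₀) ∧ f t - f t₀ ≤ R * (F t - F t₀)) :
    Tendsto (fun t => F t / f t) atTop (𝓝 1) := by
  have hlim : ∀ C R : ℝ, Tendsto (fun t => C / f t + R) atTop (𝓝 R) := fun C R => by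
    simpa using (hf.const_div_atTop C).add_const R
  refine tendsto_order.2 ⟨fun a ha => ?_, fun a ha => ?_⟩
  · have h1 : Tendsto (fun R : ℝ => R⁻¹) (𝓝[>] 1) (𝓝 1) := by
      have := (tendsto_inv₀ (one_ne_zero (α := ℝ))).mono_left (nhdsWithin_le_nhds (s := Ioi 1))
      simpa using this
    obtain ⟨R, hR, hR1⟩ := ((h1.eventually_const_lt ha).and self_mem_nhdsWithin).exists
    have hR1 : 1 < R := hR1
    obtain ⟨t₀, ht₀⟩ := h R hR1
    filter_upwards [hf.eventually_gt_atTop 0, eventually_ge_atTop t₀,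
      (hlim (F t₀ - R⁻¹ * f t₀) R⁻¹).eventually_const_lt hR] with t hpos ht hlt
    refine hlt.trans_le ?_
    have h2 := (ht₀ t ht).2
    have h3 : R⁻¹ * (f t - f t₀) ≤ F t - F t₀ := by
      rw [inv_mul_le_iff₀ (by linarith)]
      exact h2
    rw [div_add' _ _ _ hpos.ne']
    gcongr
    linarith
  · obtain ⟨R, hR1, hR⟩ := exists_between ha
    obtain ⟨t₀, ht₀⟩ := h R hR1
    filter_upwards [hf.eventually_gt_atTop 0, eventually_ge_atTop t₀,
      (hlim (F t₀ - R * f t₀) R).eventually_lt_const hR] with t hpos ht hlt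
    refine lt_of_le_of_lt ?_ hlt
    have h2 := (ht₀ t ht).1
    rw [div_add' _ _ _ hpos.ne']
    gcongr
    linarith

lemma exists_one_lt_pow_le {R : ℝ} (hR : 1 < R) (n : ℕ) : ∃ r : ℝ, 1 < r ∧ r ^ n ≤ R := by
  have h : Tendsto (fun r : ℝ => r ^ n) (𝓝[>] 1) (𝓝 1) := by
    simpa using ((continuous_pow n).tendsto (1 : ℝ)).mono_left (nhdsWithin_le_nhds (s := Ioi 1))
  obtain ⟨r, hr, hr1⟩ := ((h.eventually_lt_const hR).and self_mem_nhdsWithin).exists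
  exact ⟨r, hr1, hr.le⟩

lemma le_mul_one_sub_exp_neg {m r : ℝ} (hm : 0 ≤ m) (hr : 1 + m ≤ r) :
    m ≤ r * (1 - Real.exp (-m)) := by
  have h1 : Real.exp (-m) ≤ 1 := Real.exp_le_one_iff.2 (by linarith)
  have h2 : (1 + m) * Real.exp (-m) ≤ 1 := by
    rw [Real.exp_neg, ← div_eq_mul_inv, div_le_one (Real.exp_pos m)]
    linarith [Real.add_one_le_exp m]
  nlinarith

lemma one_sub_exp_neg_le (m : ℝ) : 1 - Real.exp (-m) ≤ m := by
  linarith [Real.add_one_le_exp (-m)]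

end Comparison

/-! ### Comparing `e^{-M(t, t + ℓ)}` with `e^{-ℓ μ(t)}` -/

section Rate

variable {μ : ℝ → ℝ}

lemma IsRateFunction.cumIntensity_eq_sub (hμ : IsRateFunction μ) {s t : ℝ} (hs : 0 ≤ s)
    (ht : 0 ≤ t) : cumIntensity μ s t = cumIntensity μ 0 t - cumIntensity μ 0 s := by
  linarith [hμ.cumIntensity_add le_rfl hs ht]

lemma IsRateFunction.tendsto_cumIntensity (hμ : IsRateFunction μ) {a b : ℝ → ℝ} {s : ℝ}
    (ha : Continuous a) (hb : Continuous b) (ha0 : ∀ t, s ≤ t → 0 ≤ a t)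
    (hb0 : ∀ t, s ≤ t → 0 ≤ b t) :
    Tendsto (fun t => cumIntensity μ (a t) (b t)) (𝓝[>] s) (𝓝 (cumIntensity μ (a s) (b s))) := by
  have key : ∀ u : ℝ → ℝ, Continuous u → (∀ t, s ≤ t → 0 ≤ u t) →
      Tendsto (fun t => cumIntensity μ 0 (u t)) (𝓝[>] s) (𝓝 (cumIntensity μ 0 (u s))) := by
    intro u hu hu0
    refine (hμ.continuousOn_cumIntensity (u s) (hu0 s le_rfl)).tendsto.comp
      (tendsto_nhdsWithin_iff.2 ⟨(hu.tendsto s).mono_left nhdsWithin_le_nhds, ?_⟩)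
    filter_upwards [self_mem_nhdsWithin] with t ht
    exact hu0 t (le_of_lt ht)
  rw [hμ.cumIntensity_eq_sub (ha0 s le_rfl) (hb0 s le_rfl)]
  refine ((key b hb hb0).sub (key a ha ha0)).congr' ?_
  filter_upwards [self_mem_nhdsWithin] with t ht
  exact (hμ.cumIntensity_eq_sub (ha0 t (le_of_lt ht)) (hb0 t (le_of_lt ht))).symm

lemma IsRateFunction.tendsto_cumIntensity_atTop (hμ : IsRateFunction μ)
    (hlim : Tendsto μ atTop atTop) {h : ℝ} (hh : 0 < h) :
    Tendsto (fun t => cumIntensity μ t (t + h)) atTop atTop := by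
  refine tendsto_atTop.2 fun K => ?_
  obtain ⟨t₀, ht₀⟩ := eventually_atTop.1 (hlim.eventually_ge_atTop (K / h))
  filter_upwards [eventually_ge_atTop (max t₀ 0)] with t ht
  have h0 : 0 ≤ t := (le_max_right _ _).trans ht
  have : ∫ _ in t..(t + h), K / h ≤ cumIntensity μ t (t + h) :=
    intervalIntegral.integral_mono_on (by linarith) (by simp)
      (hμ.intervalIntegrable h0 (by linarith))
      fun x hx => ht₀ x (((le_max_left _ _).trans ht).trans hx.1)
  rw [intervalIntegral.integral_const, smul_eq_mul] at this
  have e : (t + h - t) * (K / h) = K := by field_simp; ring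
  linarith

lemma IsRateFunction.integrableOn_exp_mul (hμ : IsRateFunction μ) {ℓ : ℝ} (hℓ : 0 ≤ ℓ)
    {s t : ℝ} (hs : 0 ≤ s) :
    IntegrableOn (fun x => Real.exp (-(ℓ * μ x)) * μ x) (Ioc s t) := by
  have hi := hμ.integrableOn (t := t) hs
  refine Integrable.mono hi ?_ ?_
  · refine AEStronglyMeasurable.mul ?_ hi.1
    exact Real.continuous_exp.comp_aestronglyMeasurable (hi.1.const_mul ℓ).neg
  · filter_upwards [hμ.ae_pos_Ioc (t := t) hs] with x hx
    rw [norm_mul, Real.norm_eq_abs, Real.abs_exp]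
    refine mul_le_of_le_one_left (norm_nonneg _) (Real.exp_le_one_iff.2 ?_)
    have := mul_nonneg hℓ hx.le
    linarith

lemma IsRateFunction.intervalIntegrable_exp_mul (hμ : IsRateFunction μ) {ℓ : ℝ} (hℓ : 0 ≤ ℓ)
    {s t : ℝ} (hs : 0 ≤ s) (ht : 0 ≤ t) :
    IntervalIntegrable (fun x => Real.exp (-(ℓ * μ x)) * μ x) volume s t :=
  ⟨hμ.integrableOn_exp_mul hℓ hs, hμ.integrableOn_exp_mul hℓ ht⟩

/-- Local comparison of `∫ e^{-ℓ μ} μ` with `e^{-M(s, s + ℓ)} M(s, t)` as `t ↓ s`. -/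
lemma IsRateFunction.eventually_integral_exp_mul (hμ : IsRateFunction μ) {ℓ : ℝ} (hℓ : 0 ≤ ℓ)
    (hM : Tendsto (fun t => cumIntensity μ t (t + ℓ) - ℓ * μ t) atTop (𝓝 0))
    {r : ℝ} (hr : 1 < r) :
    ∀ᶠ s in atTop, ∀ᶠ t in 𝓝[>] s,
      ∫ x in s..t, Real.exp (-(ℓ * μ x)) * μ x ≤
          r ^ 2 * (Real.exp (-cumIntensity μ s (s + ℓ)) * cumIntensity μ s t) ∧
        Real.exp (-cumIntensity μ s (s + ℓ)) * cumIntensity μ s t ≤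
          r ^ 2 * ∫ x in s..t, Real.exp (-(ℓ * μ x)) * μ x := by
  have hr0 : 0 < r := by linarith
  have hM1 := hM.rexp
  have hM2 := hM.neg.rexp
  rw [Real.exp_zero] at hM1
  rw [neg_zero, Real.exp_zero] at hM2
  obtain ⟨t₀, ht₀⟩ := eventually_atTop.1
    ((hM1.eventually_lt_const hr).and (hM2.eventually_lt_const hr))
  filter_upwards [eventually_ge_atTop (max t₀ 0)] with s hs
  have hs0 : 0 ≤ s := (le_max_right _ _).trans hs
  have hst₀ : t₀ ≤ s := (le_max_left _ _).trans hs
  set k : ℝ → ℝ := fun x => Real.exp (-cumIntensity μ x (x + ℓ)) with hk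
  have hkpos : ∀ x, 0 < k x := fun x => Real.exp_pos _
  have hkt : Tendsto k (𝓝[>] s) (𝓝 (k s)) :=
    (hμ.tendsto_cumIntensity continuous_id (by fun_prop) (fun t ht => hs0.trans ht)
      (fun t ht => by linarith)).neg.rexp
  -- One factor `r` pays for moving `k` from `x` back to `s` by right continuity, the other for
  -- exchanging `k x` and `exp (-(ℓ * μ x))` by `hM`.
  have e1 := hkt.eventually_lt_const (u := r * k s) (by nlinarith [hkpos s])
  have e2 := (hkt.const_mul r).eventually_const_lt (u := k s) (by nlinarith [hkpos s])
  obtain ⟨u, hu, hsub⟩ := (mem_nhdsGT_iff_exists_Ioc_subset).1 (e1.and e2)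
  filter_upwards [Ioc_mem_nhdsGT hu] with t ht
  have hst : s ≤ t := ht.1.le
  have hw := hμ.intervalIntegrable_exp_mul hℓ hs0 (hs0.trans hst)
  have hi := hμ.intervalIntegrable hs0 (hs0.trans hst)
  have hpos : ∀ᵐ x ∂(volume.restrict (Icc s t)), x ∈ Ioc s t ∧ 0 < μ x := by
    rw [← restrict_Ioc_eq_restrict_Icc]
    exact (ae_restrict_mem measurableSet_Ioc).and (hμ.ae_pos_Ioc hs0)
  have hcmp : ∀ x ∈ Ioc s t, Real.exp (-(ℓ * μ x)) ≤ r ^ 2 * k s ∧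
      k s ≤ r ^ 2 * Real.exp (-(ℓ * μ x)) := by
    intro x hx
    obtain ⟨h1, h2⟩ := hsub ⟨hx.1, hx.2.trans ht.2⟩
    obtain ⟨h3, h4⟩ := ht₀ x (hst₀.trans hx.1.le)
    have e3 : Real.exp (-(ℓ * μ x)) = Real.exp (cumIntensity μ x (x + ℓ) - ℓ * μ x) * k x := by
      simp only [hk]
      rw [← Real.exp_add]
      congr 1
      ring
    have e4 : k x = Real.exp (-(cumIntensity μ x (x + ℓ) - ℓ * μ x)) *
        Real.exp (-(ℓ * μ x)) := by
      simp only [hk]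
      rw [← Real.exp_add]
      congr 1
      ring
    constructor
    · calc Real.exp (-(ℓ * μ x)) ≤ r * k x := by
            rw [e3]
            exact mul_le_mul_of_nonneg_right h3.le (hkpos x).le
        _ ≤ r * (r * k s) := by gcongr
        _ = r ^ 2 * k s := by ring
    · calc k s ≤ r * k x := h2.le
        _ ≤ r * (r * Real.exp (-(ℓ * μ x))) := by
            rw [e4]
            gcongr
        _ = r ^ 2 * Real.exp (-(ℓ * μ x)) := by ring
  constructor
  · calc ∫ x in s..t, Real.exp (-(ℓ * μ x)) * μ x ≤ ∫ x in s..t, r ^ 2 * k s * μ x := by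
          refine intervalIntegral.integral_mono_ae_restrict hst hw (hi.const_mul _) ?_
          filter_upwards [hpos] with x hx
          exact mul_le_mul_of_nonneg_right (hcmp x hx.1).1 hx.2.le
      _ = r ^ 2 * (k s * cumIntensity μ s t) := by
          rw [intervalIntegral.integral_const_mul, cumIntensity, mul_assoc]
  · calc k s * cumIntensity μ s t = ∫ x in s..t, k s * μ x := by
          rw [intervalIntegral.integral_const_mul, cumIntensity]
      _ ≤ ∫ x in s..t, r ^ 2 * (Real.exp (-(ℓ * μ x)) * μ x) := by
          refine intervalIntegral.integral_mono_ae_restrict hst (hi.const_mul _)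
            (hw.const_mul _) ?_
          filter_upwards [hpos] with x hx
          rw [← mul_assoc]
          exact mul_le_mul_of_nonneg_right (hcmp x hx.1).2 hx.2.le
      _ = r ^ 2 * ∫ x in s..t, Real.exp (-(ℓ * μ x)) * μ x :=
          intervalIntegral.integral_const_mul _ _

/-- Far out, `hM` bounds the integrand by twice the integrable one; on the remaining bounded
interval it is at most `μ`. -/
lemma IsRateFunction.lintegral_exp_mul_lt_top (hμ : IsRateFunction μ) {ℓ c : ℝ} (hℓ : 0 ≤ ℓ)
    (hM : Tendsto (fun t => cumIntensity μ t (t + ℓ) - ℓ * μ t) atTop (𝓝 0))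
    (hi : IntegrableOn (fun x => Real.exp (-(ℓ * μ x)) * μ x) (Ioi c)) :
    ∫⁻ t in Ioi (0 : ℝ), ENNReal.ofReal (Real.exp (-cumIntensity μ t (t + ℓ)) * μ t) < ⊤ := by
  have hM2 := hM.neg.rexp
  rw [neg_zero, Real.exp_zero] at hM2
  obtain ⟨t₀, ht₀⟩ := eventually_atTop.1 (hM2.eventually_lt_const one_lt_two)
  set t₁ := max t₀ (max c 0)
  have h0 : 0 ≤ t₁ := (le_max_right _ _).trans (le_max_right _ _)
  have hc : c ≤ t₁ := (le_max_left _ _).trans (le_max_right _ _)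
  rw [← Ioc_union_Ioi_eq_Ioi h0]
  refine (lintegral_union_le _ _ _).trans_lt (ENNReal.add_lt_top.2 ⟨?_, ?_⟩)
  · refine lt_of_le_of_lt (lintegral_mono_ae ?_)
      (hasFiniteIntegral_iff_ofReal ?_ |>.1 (hμ.integrableOn (t := t₁) le_rfl).2)
    · filter_upwards [hμ.ae_pos_Ioc (t := t₁) le_rfl, ae_restrict_mem measurableSet_Ioc]
        with x hx hx2
      refine ENNReal.ofReal_le_ofReal (mul_le_of_le_one_left hx.le (Real.exp_le_one_iff.2 ?_))
      have := hμ.cumIntensity_nonneg hx2.1.le (by linarith : x ≤ x + ℓ)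
      linarith
    · exact (hμ.ae_pos_Ioc le_rfl).mono fun x hx => hx.le
  · have hp : ∀ᵐ x ∂(volume.restrict (Ioi t₁)), 0 < μ x :=
      hμ.pos.filter_mono (ae_mono (Measure.restrict_mono_set _ (Ioi_subset_Ioi h0)))
    have hi2 := (hi.mono_set (Ioi_subset_Ioi hc)).const_mul 2
    refine lt_of_le_of_lt (lintegral_mono_ae ?_) (hasFiniteIntegral_iff_ofReal ?_ |>.1 hi2.2)
    · filter_upwards [hp, ae_restrict_mem measurableSet_Ioi] with x hx hx2
      refine ENNReal.ofReal_le_ofReal ?_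
      rw [← mul_assoc]
      refine mul_le_mul_of_nonneg_right ?_ hx.le
      have h := (ht₀ x ((le_max_left _ _).trans (le_of_lt hx2))).le
      calc Real.exp (-cumIntensity μ x (x + ℓ)) =
          Real.exp (-(cumIntensity μ x (x + ℓ) - ℓ * μ x)) * Real.exp (-(ℓ * μ x)) := by
            rw [← Real.exp_add]
            congr 1
            ring
        _ ≤ 2 * Real.exp (-(ℓ * μ x)) := by gcongr
    · filter_upwards [hp] with x hx
      simp only [Pi.zero_apply]
      positivity

end Rate

/-! ### Asymptotics of the survival probability -/

section Survival

variable {Ω : Type*} [MeasurableSpace Ω] {P : Measure Ω} [IsProbabilityMeasure P] {μ : ℝ → ℝ}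
  {N : Ω → Set ℝ}

lemma IsPoissonPoint.prob_isCovered_sub_le_cumIntensity (hN : IsPoissonPoint P μ N)
    (hμ : IsRateFunction μ) {ℓ s t : ℝ} (hs : 0 ≤ s) (hst : s ≤ t) (hts : t ≤ s + ℓ) :
    P.real {ω | IsCovered ℓ (s + ℓ) (N ω)} - P.real {ω | IsCovered ℓ (t + ℓ) (N ω)} ≤
      cumIntensity μ s t := by
  have hm := hμ.cumIntensity_nonneg hs hst
  have h1 : (0 : ℝ) ≤ 1 - Real.exp (-cumIntensity μ s t) := by
    rw [sub_nonneg, Real.exp_le_one_iff]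
    linarith
  have h2 : Real.exp (-cumIntensity μ t (s + ℓ)) ≤ 1 := by
    rw [Real.exp_le_one_iff]
    linarith [hμ.cumIntensity_nonneg (hs.trans hst) hts]
  refine (hN.prob_isCovered_sub_le hμ hs hst hts).trans ?_
  refine le_trans ?_ (one_sub_exp_neg_le (cumIntensity μ s t))
  refine (mul_le_of_le_one_right (mul_nonneg measureReal_nonneg h1) h2).trans ?_
  exact mul_le_of_le_one_left h1 measureReal_le_one

lemma prob_isCovered_anti (ℓ : ℝ) :
    Antitone fun t : ℝ => P.real {ω | IsCovered ℓ (t + ℓ) (N ω)} :=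
  fun s t hst => measureReal_mono fun ω h => IsCovered.anti (by linarith) h

/-- Increments are dominated by those of the continuous function `cumIntensity μ 0`. -/
lemma IsPoissonPoint.continuousOn_prob_isCovered (hN : IsPoissonPoint P μ N)
    (hμ : IsRateFunction μ) {ℓ : ℝ} (hℓ : 0 < ℓ) :
    ContinuousOn (fun t : ℝ => P.real {ω | IsCovered ℓ (t + ℓ) (N ω)}) (Ici 0) := by
  intro s hs
  have hs0 : 0 ≤ s := hs
  have hΦ := (hμ.continuousOn_cumIntensity s hs).tendsto
  have h0 : Tendsto (fun t => |cumIntensity μ 0 t - cumIntensity μ 0 s|) (𝓝[Ici 0] s) (𝓝 0) := by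
    simpa using (hΦ.sub_const (cumIntensity μ 0 s)).abs
  refine tendsto_iff_dist_tendsto_zero.2
    (squeeze_zero' (Eventually.of_forall fun _ => dist_nonneg) ?_ h0)
  have hnear : Icc (s - ℓ) (s + ℓ) ∈ 𝓝[Ici 0] s :=
    mem_nhdsWithin_of_mem_nhds (Icc_mem_nhds (by linarith) (by linarith))
  filter_upwards [self_mem_nhdsWithin, hnear] with t ht htℓ
  have ht0 : 0 ≤ t := ht
  have hanti := prob_isCovered_anti (P := P) (N := N) ℓ
  rw [Real.dist_eq]
  rcases le_total s t with hst | hst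
  · have h1 := hN.prob_isCovered_sub_le_cumIntensity hμ hs0 hst htℓ.2
    have h2 := hanti hst
    simp only at h2
    rw [hμ.cumIntensity_eq_sub hs0 ht0] at h1
    rw [abs_of_nonpos (by linarith)]
    exact le_trans (by linarith) (le_abs_self _)
  · have h1 := hN.prob_isCovered_sub_le_cumIntensity (ℓ := ℓ) hμ ht0 hst (by linarith [htℓ.1])
    have h2 := hanti hst
    simp only at h2
    rw [hμ.cumIntensity_eq_sub ht0 hs0] at h1
    rw [abs_of_nonneg (by linarith)]
    exact le_trans (by linarith) (neg_le_abs _)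

/-- As `μ → ∞`, both half windows around `t` contain a point with probability tending to 1. -/
lemma IsPoissonPoint.eventually_prob_isCovered_le (hN : IsPoissonPoint P μ N)
    (hμ : IsRateFunction μ) (hlim : Tendsto μ atTop atTop) {ℓ : ℝ} (hℓ : 0 < ℓ) {r : ℝ}
    (hr : 1 < r) :
    ∀ᶠ t in atTop, P.real {ω | IsCovered ℓ t (N ω)} ≤
      r * P.real {ω | IsCovered ℓ (t + ℓ) (N ω)} := by
  have h1 := hμ.tendsto_cumIntensity_atTop hlim (half_pos hℓ)
  have h2 : Tendsto (fun t => cumIntensity μ (t - ℓ / 2) t) atTop atTop := by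
    refine (h1.comp (tendsto_atTop_add_const_right atTop (-(ℓ / 2)) tendsto_id)).congr fun t => ?_
    simp [← sub_eq_add_neg]
  have h3 : Tendsto (fun t => r * ((1 - Real.exp (-cumIntensity μ (t - ℓ / 2) t)) *
      (1 - Real.exp (-cumIntensity μ t (t + ℓ / 2))))) atTop (𝓝 r) := by
    have e1 := (Real.tendsto_exp_neg_atTop_nhds_zero.comp h1).const_sub 1
    have e2 := (Real.tendsto_exp_neg_atTop_nhds_zero.comp h2).const_sub 1
    simpa using (e2.mul e1).const_mul r
  filter_upwards [h3.eventually_const_lt hr, eventually_ge_atTop (ℓ / 2)] with t h4 ht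
  have h5 := hN.mul_le_prob_isCovered_add hμ hℓ ht
  have h6 : 0 ≤ P.real {ω | IsCovered ℓ t (N ω)} := measureReal_nonneg
  nlinarith

/-- Local comparison of `-log P(D > t)` with `e^{-M(s, s + ℓ)} M(s, t)` as `t ↓ s`. -/
lemma IsPoissonPoint.eventually_log_prob_isCovered (hN : IsPoissonPoint P μ N)
    (hμ : IsRateFunction μ) (hlim : Tendsto μ atTop atTop) {ℓ : ℝ} (hℓ : 0 < ℓ) {r : ℝ}
    (hr : 1 < r) :
    ∀ᶠ s in atTop, ∀ᶠ t in 𝓝[>] s,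
      Real.log (P.real {ω | IsCovered ℓ (s + ℓ) (N ω)}) -
          Real.log (P.real {ω | IsCovered ℓ (t + ℓ) (N ω)}) ≤
          r ^ 3 * (Real.exp (-cumIntensity μ s (s + ℓ)) * cumIntensity μ s t) ∧
        Real.exp (-cumIntensity μ s (s + ℓ)) * cumIntensity μ s t ≤
          r ^ 3 * (Real.log (P.real {ω | IsCovered ℓ (s + ℓ) (N ω)}) -
            Real.log (P.real {ω | IsCovered ℓ (t + ℓ) (N ω)})) := by
  have hr0 : 0 < r := by linarith
  filter_upwards [hN.eventually_prob_isCovered_le hμ hlim hℓ hr, eventually_ge_atTop 0]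
    with s hgs hs
  have hid : Continuous fun t : ℝ => t := continuous_id
  have T1 := hμ.tendsto_cumIntensity (a := fun _ => s) (b := fun t => t) (s := s)
    continuous_const hid (fun t ht => hs) (fun t ht => hs.trans ht)
  have T2 := (hμ.tendsto_cumIntensity (a := fun t => t) (b := fun _ => s + ℓ) (s := s)
    hid continuous_const (fun t ht => hs.trans ht) (fun t ht => by linarith)).neg.rexp
  have T3 := (hμ.tendsto_cumIntensity (a := fun t => t) (b := fun t => t + ℓ) (s := s)
    hid (by fun_prop) (fun t ht => hs.trans ht) (fun t ht => by linarith)).neg.rexp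
  have T4 : Tendsto (fun t : ℝ => P.real {ω | IsCovered ℓ (t + ℓ) (N ω)}) (𝓝[>] s)
      (𝓝 (P.real {ω | IsCovered ℓ (s + ℓ) (N ω)})) :=
    (hN.continuousOn_prob_isCovered hμ hℓ s hs).tendsto.mono_left
      (nhdsWithin_mono s fun t ht => hs.trans (le_of_lt ht))
  have hp : ∀ t, 0 < P.real {ω | IsCovered ℓ t (N ω)} := hN.prob_isCovered_pos hμ hℓ
  have hk := Real.exp_pos (-cumIntensity μ s (s + ℓ))
  have E1 : ∀ᶠ t in 𝓝[>] s, cumIntensity μ s t < r - 1 :=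
    T1.eventually_lt_const (by simpa [cumIntensity] using hr)
  have E2 := T2.eventually_lt_const
    (u := r * Real.exp (-cumIntensity μ s (s + ℓ))) (by nlinarith)
  have E3 := (T3.const_mul r).eventually_const_lt
    (u := Real.exp (-cumIntensity μ s (s + ℓ))) (by nlinarith)
  have E4 := (T4.const_mul r).eventually_const_lt
    (u := P.real {ω | IsCovered ℓ (s + ℓ) (N ω)}) (by nlinarith [hp (s + ℓ)])
  filter_upwards [E1, E2, E3, E4, Ioc_mem_nhdsGT (by linarith : s < s + ℓ)] with t h1 h2 h3 h4 ht
  have hst : s ≤ t := ht.1.le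
  have hm := hμ.cumIntensity_nonneg hs hst
  have hup := hN.prob_isCovered_sub_le hμ hs hst ht.2
  have hlow := hN.le_prob_isCovered_sub hμ hs hst ht.2
  have hgt : P.real {ω | IsCovered ℓ (t + ℓ) (N ω)} ≤ P.real {ω | IsCovered ℓ t (N ω)} :=
    measureReal_mono fun ω h => IsCovered.anti (by linarith) h
  have hm1 := one_sub_exp_neg_le (cumIntensity μ s t)
  have hm2 := le_mul_one_sub_exp_neg hm (r := r) (by linarith)
  have hps := hp (s + ℓ)
  have hpt := hp (t + ℓ)
  rw [← Real.log_div hps.ne' hpt.ne']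
  set ps := P.real {ω | IsCovered ℓ (s + ℓ) (N ω)}
  set pt := P.real {ω | IsCovered ℓ (t + ℓ) (N ω)}
  set k := Real.exp (-cumIntensity μ s (s + ℓ))
  set m := cumIntensity μ s t
  have he0 : 0 ≤ 1 - Real.exp (-m) := by
    rw [sub_nonneg, Real.exp_le_one_iff]
    linarith
  constructor
  -- The three factors `r` pay for covering up to `s` against `ps`, for `ps` against `pt`, and for
  -- the void probability against `k`. In the lower bound the first is replaced by `m` against `1 -
  -- exp (-m)`.
  · have hd : ps - pt ≤ r ^ 3 * (k * m) * pt := by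
      refine hup.trans ?_
      calc _ ≤ (r * ps) * m * (r * k) := by gcongr
        _ ≤ (r * (r * pt)) * m * (r * k) := by gcongr
        _ = r ^ 3 * (k * m) * pt := by ring
    refine (Real.log_le_sub_one_of_pos (by positivity)).trans ?_
    rw [div_sub_one hpt.ne', div_le_iff₀ hpt]
    exact hd
  · have hd : k * m * ps ≤ r ^ 3 * (ps - pt) := by
      calc k * m * ps ≤ (r * Real.exp (-cumIntensity μ t (t + ℓ))) *
            (r * (1 - Real.exp (-m))) * (r * pt) := by gcongr
        _ = r ^ 3 * (pt * (1 - Real.exp (-m)) * Real.exp (-cumIntensity μ t (t + ℓ))) := by ring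
        _ ≤ r ^ 3 * (P.real {ω | IsCovered ℓ t (N ω)} * (1 - Real.exp (-m)) *
            Real.exp (-cumIntensity μ t (t + ℓ))) := by gcongr
        _ ≤ r ^ 3 * (ps - pt) := by gcongr
    have hl := Real.one_sub_inv_le_log_of_pos (x := ps / pt) (by positivity)
    rw [inv_div, one_sub_div hps.ne'] at hl
    calc k * m = k * m * ps / ps := by field_simp
      _ ≤ r ^ 3 * (ps - pt) / ps := by gcongr
      _ = r ^ 3 * ((ps - pt) / ps) := by ring
      _ ≤ r ^ 3 * Real.log (ps / pt) := by gcongr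

/-- Global comparison of `-log P(D > t)` with `∫ e^{-ℓ μ} μ`. -/
lemma IsPoissonPoint.exists_log_prob_isCovered (hN : IsPoissonPoint P μ N)
    (hμ : IsRateFunction μ) (hlim : Tendsto μ atTop atTop) {ℓ : ℝ} (hℓ : 0 < ℓ)
    (hM : Tendsto (fun t => cumIntensity μ t (t + ℓ) - ℓ * μ t) atTop (𝓝 0))
    {c : ℝ} (hc : 0 ≤ c) {R : ℝ} (hR : 1 < R) :
    ∃ t₀, ∀ t, t₀ ≤ t →
      -Real.log (P.real {ω | IsCovered ℓ (t + ℓ) (N ω)}) -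
          -Real.log (P.real {ω | IsCovered ℓ (t₀ + ℓ) (N ω)}) ≤
        R * ((∫ x in c..t, Real.exp (-(ℓ * μ x)) * μ x) -
          ∫ x in c..t₀, Real.exp (-(ℓ * μ x)) * μ x) ∧
      (∫ x in c..t, Real.exp (-(ℓ * μ x)) * μ x) -
          (∫ x in c..t₀, Real.exp (-(ℓ * μ x)) * μ x) ≤
        R * (-Real.log (P.real {ω | IsCovered ℓ (t + ℓ) (N ω)}) -
          -Real.log (P.real {ω | IsCovered ℓ (t₀ + ℓ) (N ω)})) := by
  -- The exponent is 3 from the logarithm of the survival probability plus 2 from the rate.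
  obtain ⟨r, hr, hrR⟩ := exists_one_lt_pow_le hR 5
  have hr0 : 0 < r := by linarith
  obtain ⟨t₀, ht₀⟩ := eventually_atTop.1
    (((hN.eventually_log_prob_isCovered hμ hlim hℓ hr).and
      (hμ.eventually_integral_exp_mul hℓ.le hM hr)).and (eventually_ge_atTop 0))
  have h0 : 0 ≤ t₀ := (ht₀ t₀ le_rfl).2
  refine ⟨t₀, fun t ht => ?_⟩
  have hint : ∀ a b, 0 ≤ a → 0 ≤ b →
      IntervalIntegrable (fun x => Real.exp (-(ℓ * μ x)) * μ x) volume a b :=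
    fun a b ha hb => hμ.intervalIntegrable_exp_mul hℓ.le ha hb
  have hsub : ∀ a b, 0 ≤ a → 0 ≤ b → (∫ x in c..b, Real.exp (-(ℓ * μ x)) * μ x) -
      (∫ x in c..a, Real.exp (-(ℓ * μ x)) * μ x) = ∫ x in a..b, Real.exp (-(ℓ * μ x)) * μ x :=
    fun a b ha hb => intervalIntegral.integral_interval_sub_left (hint c b hc hb) (hint c a hc ha)
  have hf : ContinuousOn (fun t => ∫ x in c..t, Real.exp (-(ℓ * μ x)) * μ x) (Icc t₀ t) := by
    -- The base point `c` may lie on either side of `t₀`, so continuity is taken on an interval from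
    -- 0 containing both `c` and `t`.
    refine (intervalIntegral.continuousOn_primitive_interval' (b₁ := 0) (b₂ := max c t)
      (hint _ _ le_rfl (by positivity)) ?_).mono ?_
    · rw [uIcc_of_le (by positivity)]
      exact ⟨hc, le_max_left _ _⟩
    · rw [uIcc_of_le (by positivity)]
      exact Icc_subset_Icc h0 (le_max_right _ _)
  have hF : ContinuousOn (fun t => -Real.log (P.real {ω | IsCovered ℓ (t + ℓ) (N ω)}))
      (Icc t₀ t) :=
    (((hN.continuousOn_prob_isCovered hμ hℓ).mono fun x hx => h0.trans hx.1).log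
      fun x _ => (hN.prob_isCovered_pos hμ hℓ _).ne').neg
  have hloc : ∀ s ∈ Ico t₀ t, ∀ᶠ t in 𝓝[>] s,
      -Real.log (P.real {ω | IsCovered ℓ (t + ℓ) (N ω)}) -
          -Real.log (P.real {ω | IsCovered ℓ (s + ℓ) (N ω)}) ≤
        r ^ 5 * (∫ x in c..t, Real.exp (-(ℓ * μ x)) * μ x) -
          r ^ 5 * ∫ x in c..s, Real.exp (-(ℓ * μ x)) * μ x := by
    intro s hs
    have hs0 := h0.trans hs.1
    filter_upwards [(ht₀ s hs.1).1.1, (ht₀ s hs.1).1.2, self_mem_nhdsWithin] with u h1 h2 hu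
    rw [← mul_sub, hsub s u hs0 (hs0.trans (le_of_lt hu)), neg_sub_neg]
    refine h1.1.trans ((mul_le_mul_of_nonneg_left h2.2 (by positivity)).trans_eq (by ring))
  have hloc' : ∀ s ∈ Ico t₀ t, ∀ᶠ t in 𝓝[>] s,
      (∫ x in c..t, Real.exp (-(ℓ * μ x)) * μ x) -
          (∫ x in c..s, Real.exp (-(ℓ * μ x)) * μ x) ≤
        r ^ 5 * -Real.log (P.real {ω | IsCovered ℓ (t + ℓ) (N ω)}) -
          r ^ 5 * -Real.log (P.real {ω | IsCovered ℓ (s + ℓ) (N ω)}) := by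
    intro s hs
    have hs0 := h0.trans hs.1
    filter_upwards [(ht₀ s hs.1).1.1, (ht₀ s hs.1).1.2, self_mem_nhdsWithin] with u h1 h2 hu
    rw [← mul_sub, hsub s u hs0 (hs0.trans (le_of_lt hu)), neg_sub_neg]
    refine h2.1.trans ((mul_le_mul_of_nonneg_left h1.2 (by positivity)).trans_eq (by ring))
  have g1 := sub_le_sub_of_eventually_nhdsGT ht hF (hf.const_mul (r ^ 5)) hloc
  have g2 := sub_le_sub_of_eventually_nhdsGT ht hf (hF.const_mul (r ^ 5)) hloc'
  rw [← mul_sub] at g1 g2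
  have hfn : 0 ≤ (∫ x in c..t, Real.exp (-(ℓ * μ x)) * μ x) -
      ∫ x in c..t₀, Real.exp (-(ℓ * μ x)) * μ x := by
    rw [hsub t₀ t h0 (h0.trans ht)]
    refine intervalIntegral.integral_nonneg_of_ae_restrict ht ?_
    rw [← restrict_Ioc_eq_restrict_Icc]
    filter_upwards [hμ.ae_pos_Ioc (t := t) h0] with x hx
    simp only [Pi.zero_apply]
    positivity
  have hFn : 0 ≤ -Real.log (P.real {ω | IsCovered ℓ (t + ℓ) (N ω)}) -
      -Real.log (P.real {ω | IsCovered ℓ (t₀ + ℓ) (N ω)}) := by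
    rw [neg_sub_neg, sub_nonneg]
    exact Real.log_le_log (hN.prob_isCovered_pos hμ hℓ _) (prob_isCovered_anti ℓ ht)
  exact ⟨g1.trans (mul_le_mul_of_nonneg_right hrR hfn),
    g2.trans (mul_le_mul_of_nonneg_right hrR hFn)⟩

/-- The integral is nondecreasing in `t`, so failing to diverge means being bounded. Then the global
comparison bounds `-log p`, contradicting `p → 0` when `D < ∞` almost surely; under the other
alternative, integrability contradicts the infinite integral. -/
lemma IsPoissonPoint.tendsto_integral_exp_mul (hN : IsPoissonPoint P μ N)
    (hμ : IsRateFunction μ) (hlim : Tendsto μ atTop atTop) {ℓ : ℝ} (hℓ : 0 < ℓ)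
    (hM : Tendsto (fun t => cumIntensity μ t (t + ℓ) - ℓ * μ t) atTop (𝓝 0))
    (hfin : (∀ᵐ ω ∂P, firstGap ℓ (N ω) < ⊤) ∨
      ∫⁻ t in Ioi (0 : ℝ),
        ENNReal.ofReal (Real.exp (-cumIntensity μ t (t + ℓ)) * μ t) = ⊤)
    {c : ℝ} (hc : 0 ≤ c) :
    Tendsto (fun t => ∫ x in c..t, Real.exp (-(ℓ * μ x)) * μ x) atTop atTop := by
  have hnn : ∀ a b, c ≤ a → ∀ᵐ x ∂(volume.restrict (Ioc a b)),
      0 ≤ Real.exp (-(ℓ * μ x)) * μ x := by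
    intro a b ha
    filter_upwards [hμ.ae_pos_Ioc (t := b) (hc.trans ha)] with x hx
    positivity
  by_contra hnot
  obtain ⟨B, hB⟩ : ∃ B, ∀ t, c ≤ t → ∫ x in c..t, Real.exp (-(ℓ * μ x)) * μ x ≤ B := by
    rw [tendsto_atTop] at hnot
    push Not at hnot
    obtain ⟨B, hB⟩ := hnot
    refine ⟨B, fun t ht => ?_⟩
    obtain ⟨u, htu, hu⟩ := frequently_atTop.1 hB t
    refine le_trans ?_ hu.le
    refine intervalIntegral.integral_mono_interval le_rfl ht htu ?_
      (hμ.intervalIntegrable_exp_mul hℓ.le hc (hc.trans (ht.trans htu)))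
    exact hnn c u le_rfl
  rcases hfin with hfin | hfin
  · obtain ⟨t₀, ht₀⟩ := hN.exists_log_prob_isCovered hμ hlim hℓ hM hc one_lt_two
    have hlog := (Real.tendsto_log_nhdsGT_zero.comp (tendsto_nhdsWithin_iff.2
      ⟨hN.tendsto_prob_isCovered hμ hfin,
        Eventually.of_forall fun t => hN.prob_isCovered_pos hμ hℓ _⟩))
    have hlt := hlog.eventually_lt_atBot
      (Real.log (P.real {ω | IsCovered ℓ (t₀ + ℓ) (N ω)}) -
        2 * (B - ∫ x in c..t₀, Real.exp (-(ℓ * μ x)) * μ x))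
    obtain ⟨t, h1, h2, h3⟩ :=
      (hlt.and ((eventually_ge_atTop t₀).and (eventually_ge_atTop c))).exists
    have h4 := (ht₀ t h2).1
    have h5 := hB t h3
    simp only [Function.comp_apply] at h1
    linarith
  · refine (hμ.lintegral_exp_mul_lt_top (c := c) hℓ.le hM ?_).ne hfin
    refine integrableOn_Ioi_of_intervalIntegral_norm_bounded (l := atTop) (b := id) B c
      (fun t => hμ.integrableOn_exp_mul hℓ.le hc) tendsto_id ?_
    filter_upwards [eventually_ge_atTop c] with t ht
    refine le_of_eq_of_le ?_ (hB t ht)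
    rw [id, intervalIntegral.integral_of_le ht, intervalIntegral.integral_of_le ht]
    refine integral_congr_ae ?_
    filter_upwards [hnn c t le_rfl] with x hx
    exact Real.norm_of_nonneg hx

end Survival

end LongestGap

theorem mainTheorem4 {Ω : Type*} [MeasurableSpace Ω] (P : Measure Ω) [IsProbabilityMeasure P]
    (μ : ℝ → ℝ) (hμ : LongestGap.IsRateFunction μ)
    (N : Ω → Set ℝ) (hN : LongestGap.IsPoissonPoint P μ N)
    (ℓ : ℝ) (hℓ : 0 < ℓ)
    (hcont : ∀ᵐ t ∂(volume.restrict (Ioi (0 : ℝ))), ContinuousAt μ t)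
    (hlim : Tendsto μ atTop atTop)
    (hM : Tendsto (fun t => LongestGap.cumIntensity μ t (t + ℓ) - ℓ * μ t) atTop (𝓝 0))
    (hfin : (∀ᵐ ω ∂P, LongestGap.firstGap ℓ (N ω) < ⊤) ∨
      ∫⁻ t in Ioi (0 : ℝ),
        ENNReal.ofReal (Real.exp (-LongestGap.cumIntensity μ t (t + ℓ)) * μ t) = ⊤)
    (c : ℝ) (hc : 0 ≤ c) :
    LongestGap.LogAsymp
      (fun t => P.real {ω | (t : EReal) < LongestGap.firstGap ℓ (N ω)})
      (fun t => Real.exp (-∫ s in c..t, Real.exp (-(ℓ * μ s)) * μ s)) := by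
  have h := LongestGap.tendsto_div_nhds_one
    (hN.tendsto_integral_exp_mul hμ hlim hℓ hM hfin hc)
    (fun R hR => hN.exists_log_prob_isCovered hμ hlim hℓ hM hc hR)
  refine h.congr' ?_
  filter_upwards [eventually_ge_atTop 0] with t ht
  simp only [hN.prob_lt_firstGap hμ ℓ ht, Real.log_exp]
  rw [div_neg, neg_div]
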